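/- Let $N\ge 3$. A pure $N$-qubit state is a unit vector $|\psi\rangle\in(\mathbb C^2)^{\otimes N}$; it is called entangled if it is not a product $|v_1\rangle\otimes\cdots\otimes|v_N\rangle$ of single-qubit states. A mixed state is called separable if it is a finite convex combination of projectors onto product states, and entangled otherwise. An entangled state $|\psi\rangle$ is fragile (resp. robust) with respect to the loss of the $k$th qubit if the partial trace $\mathrm{Tr}_k(|\psi\rangle\langle\psi|)$ is separable (resp. entangled). Two pure states are SLOCC-equivalent if one is the image of the other under an invertible local operation $\bigotimes_{i=1}^N A_i$, with $A_i\in GL_2(\mathbb C)$. Put $|\mathrm{GHZ}_N\rangle=(|0,\ldots,0\rangle+|1,\ldots,1\rangle)/\sqrt2$. (i) Every entangled $N$-qubit state $|\psi\rangle$ that is fragile with respect to the loss of the $k$th qubit for each $k=1,\ldots,N$ is SLOCC-equivalent to $|\mathrm{GHZ}_N\rangle$. More precisely, $|\psi\rangle$ can be written in the form $$|\psi\rangle=a\,|e_1,\ldots,e_N\rangle+b\,|e_1^\perp,\ldots,e_N^\perp\rangle ,$$ where $(|e_i\rangle,|e_i^\perp\rangle)$ are pairs of orthonormal single-qubit states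 and $a,b$ are nonzero complex numbers with $|a|^2+|b|^2=1$. For every such decomposition there are unitary $2\times2$ matrices $U_i$ with $U_i|e_i\rangle=|0\rangle$ and $U_i|e_i^\perp\rangle=|1\rangle$ for all $i$, and for any such $U_i$ one has $$|\mathrm{GHZ}_N\rangle=\Bigl(\bigotimes_{i=1}^N D\,U_i\Bigr)|\psi\rangle,\qquad D=\mathrm{diag}\bigl[(\sqrt2\,a)^{-1/N},(\sqrt2\,b)^{-1/N}\bigr],$$ (principal roots), with all the matrices $D\,U_i$ invertible. (ii) The SLOCC class of $|\mathrm{GHZ}_N\rangle$ also contains robust states: there is a pure state SLOCC-equivalent to $|\mathrm{GHZ}_N\rangle$ that is entangled and robust with respect to the loss of the $k$th qubit for each $k=1,\ldots,N$. -/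

import Mathlib

open scoped Matrix

noncomputable section

namespace QubitLoss

/-- The Hilbert space of a single qubit. -/
abbrev Qubit : Type := EuclideanSpace ℂ (Fin 2)

/-- The Hilbert space of a system of qubits labelled by `ι`, in the computational basis. -/
abbrev QubitSystem (ι : Type*) [Fintype ι] : Type _ := EuclideanSpace ℂ (ι → Fin 2)

variable {ι : Type*} [Fintype ι] [DecidableEq ι]

/-- The computational basis state `|b⟩` of a single qubit. -/
def ket (b : Fin 2) : Qubit := EuclideanSpace.single b 1

/-- The product vector `⊗ᵢ |vᵢ⟩`. -/
def prodVec (v : ι → Qubit) : QubitSystem ι :=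
  WithLp.toLp 2 fun x => ∏ i, v i (x i)

/-- The rank-one operator `|ψ⟩⟨ψ|`. -/
def ketBra (ψ : QubitSystem ι) : Matrix (ι → Fin 2) (ι → Fin 2) ℂ :=
  Matrix.of fun x y => ψ x * star (ψ y)

/-- A pure state (unit vector) is entangled if it is not a product of single-qubit states. -/
def IsEntangled (ψ : QubitSystem ι) : Prop :=
  ‖ψ‖ = 1 ∧ ¬ ∃ v : ι → Qubit, (∀ i, ‖v i‖ = 1) ∧ ψ = prodVec v

/-- An operator is a (fully) separable state if it is a finite convex combination of projectors
onto product states. -/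
def IsSeparableState (ρ : Matrix (ι → Fin 2) (ι → Fin 2) ℂ) : Prop :=
  ∃ (n : ℕ) (p : Fin n → ℝ) (v : Fin n → ι → Qubit),
    (∀ j, 0 ≤ p j) ∧ ∑ j, p j = 1 ∧ (∀ j i, ‖v j i‖ = 1) ∧
      ρ = ∑ j, (p j : ℂ) • ketBra (prodVec (v j))

/-- The computational basis label that is `b` at `k` and agrees with `x` elsewhere. -/
def insertBit (k : ι) (b : Fin 2) (x : {i : ι // i ≠ k} → Fin 2) : ι → Fin 2 :=
  fun i => if h : i = k then b else x ⟨i, h⟩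

/-- The partial trace `Tr_k` over the `k`th qubit. -/
def partialTrace (k : ι) (ρ : Matrix (ι → Fin 2) (ι → Fin 2) ℂ) :
    Matrix ({i : ι // i ≠ k} → Fin 2) ({i : ι // i ≠ k} → Fin 2) ℂ :=
  Matrix.of fun x y => ∑ b : Fin 2, ρ (insertBit k b x) (insertBit k b y)

/-- `ψ` is an entangled state that is fragile with respect to the loss of the `k`th qubit. -/
def IsFragile (k : ι) (ψ : QubitSystem ι) : Prop :=
  IsEntangled ψ ∧ IsSeparableState (partialTrace k (ketBra ψ))

/-- `ψ` is an entangled state that is robust with respect to the loss of the `k`th qubit. -/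
def IsRobust (k : ι) (ψ : QubitSystem ι) : Prop :=
  IsEntangled ψ ∧ ¬ IsSeparableState (partialTrace k (ketBra ψ))

/-- The result of applying the local operation `⊗ᵢ Aᵢ` to `ψ`. -/
def localOp (A : ι → Matrix (Fin 2) (Fin 2) ℂ) (ψ : QubitSystem ι) : QubitSystem ι :=
  WithLp.toLp 2 fun x => ∑ y : ι → Fin 2, (∏ i, A i (x i) (y i)) * ψ y

/-- SLOCC-equivalence: the states are connected by an invertible local operation. -/
def SLOCCEquiv (ψ φ : QubitSystem ι) : Prop :=
  ∃ A : ι → Matrix (Fin 2) (Fin 2) ℂ, (∀ i, IsUnit (A i)) ∧ φ = localOp A ψ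

/-- The SLOCC class of `φ`: all (normalized) pure states that are SLOCC-equivalent to `φ`. -/
def SLOCCClass (φ : QubitSystem ι) : Set (QubitSystem ι) :=
  {ψ | ‖ψ‖ = 1 ∧ SLOCCEquiv ψ φ}

/-- The state `(|0…0⟩ + |1…1⟩)/√2` of `N` qubits. -/
def GHZ (N : ℕ) : QubitSystem (Fin N) :=
  ((Real.sqrt 2 : ℂ)⁻¹) • (prodVec (fun _ => ket 0) + prodVec (fun _ => ket 1))

/-- `ψ = a |e₁,…,e_N⟩ + b |e'₁,…,e'_N⟩` with orthonormal pairs `(eᵢ, e'ᵢ)`, `a, b ≠ 0` and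
`|a|² + |b|² = 1`. -/
structure IsGHZForm (ψ : QubitSystem ι) (a b : ℂ) (e e' : ι → Qubit) : Prop where
  left_ne_zero : a ≠ 0
  right_ne_zero : b ≠ 0
  normalized : ‖a‖ ^ 2 + ‖b‖ ^ 2 = 1
  norm_left : ∀ i, ‖e i‖ = 1
  norm_right : ∀ i, ‖e' i‖ = 1
  orthogonal : ∀ i, inner ℂ (e i) (e' i) = 0
  eq : ψ = a • prodVec e + b • prodVec e'

/-- The matrix `diag((√2 a)^(-1/N), (√2 b)^(-1/N))`, with principal roots. -/
def scaling (N : ℕ) (a b : ℂ) : Matrix (Fin 2) (Fin 2) ℂ :=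
  Matrix.diagonal ![((Real.sqrt 2 : ℂ) * a) ^ (-(1 : ℂ) / N),
    ((Real.sqrt 2 : ℂ) * b) ^ (-(1 : ℂ) / N)]

/-- Each `Uᵢ` is unitary with `Uᵢ|eᵢ⟩ = |0⟩` and `Uᵢ|e'ᵢ⟩ = |1⟩`. -/
def AlignsToComputationalBasis (e e' : ι → Qubit) (U : ι → Matrix (Fin 2) (Fin 2) ℂ) : Prop :=
  ∀ i, U i ∈ Matrix.unitaryGroup (Fin 2) ℂ ∧
    U i *ᵥ (e i).ofLp = (ket 0).ofLp ∧ U i *ᵥ (e' i).ofLp = (ket 1).ofLp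

end QubitLoss

end

noncomputable section

namespace QubitLoss

/-! The state left after losing qubit `k` is the sum of `|s_b⟩⟨s_b|` over its two slices, so its
range is their span, of dimension at most two. Separability says that product vectors span this
range (`span_slice_eq`). Hence both slices lie in the span of two product vectors, and `ψ = ⊗uᵢ +
⊗wᵢ`.

Fragility forces `uᵢ` and `wᵢ` to be independent: otherwise qubit `i` splits off, the range is a
line containing a product vector, and `ψ` is a product (`pairDet_ne_zero_of_isFragile`). An
invertible local operation then carries the span of the two remaining terms to that of `|0…0⟩` and
`|1…1⟩`. With at least two qubits left, the only product vectors there lie on these two lines, so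
the reduced state has no coherence between them. That coherence is a nonzero multiple of
`⟨u_k|w_k⟩`, so the pairs are orthogonal (`inner_eq_zero_of_isSeparableState`). Normalizing gives
the GHZ form.

The same criterion gives (ii): independent but non-orthogonal pairs yield a robust state in the GHZ
class. -/

theorem exists_alignsToComputationalBasis {ι : Type*} {e e' : ι → Qubit}
    (he : ∀ i, ‖e i‖ = 1)
    (he' : ∀ i, ‖e' i‖ = 1) (horth : ∀ i, inner ℂ (e i) (e' i) = 0) :
    ∃ U, AlignsToComputationalBasis e e' U := by
  have hi : ∀ u w : Qubit, inner ℂ u w = star (u 0) * w 0 + star (u 1) * w 1 := fun u w => by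
    simp [PiLp.inner_apply, mul_comm]
  have h1 : ∀ u : Qubit, ‖u‖ = 1 → star (u 0) * u 0 + star (u 1) * u 1 = 1 := fun u hu => by
    rw [← hi, inner_self_eq_norm_sq_to_K, hu]
    simp
  -- The rows are the bras of `e i` and `e' i`.
  refine ⟨fun i => !![star (e i 0), star (e i 1); star (e' i 0), star (e' i 1)], fun i => ?_⟩
  have h01 := horth i
  have h10 := inner_eq_zero_symm.1 h01
  have h00 := h1 _ (he i)
  have h11 := h1 _ (he' i)
  rw [hi] at h01 h10
  refine ⟨?_, ?_, ?_⟩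
  · rw [Matrix.mem_unitaryGroup_iff]
    ext r c
    fin_cases r <;> fin_cases c <;>
      simpa [Matrix.mul_apply, Fin.sum_univ_two, Matrix.star_apply] using by assumption
  · ext r
    fin_cases r <;> simpa [Matrix.mulVec, dotProduct, ket] using by assumption
  · ext r
    fin_cases r <;> simpa [Matrix.mulVec, dotProduct, ket] using by assumption

/-! ### Product vectors and local operations -/

variable {ι : Type*} [Fintype ι]

theorem prodVec_apply (v : ι → Qubit) (x : ι → Fin 2) : prodVec v x = ∏ i, v i (x i) := rfl

theorem prodVec_smul (c : ι → ℂ) (v : ι → Qubit) :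
    prodVec (fun i => c i • v i) = (∏ i, c i) • prodVec v := by
  ext x
  simp [prodVec_apply, Finset.prod_mul_distrib]

theorem inner_prodVec [DecidableEq ι] (u v : ι → Qubit) :
    inner ℂ (prodVec u) (prodVec v) = ∏ i, inner ℂ (u i) (v i) := by
  simp only [PiLp.inner_apply, prodVec_apply, RCLike.inner_apply, map_prod,
    ← Finset.prod_mul_distrib]
  rw [Finset.prod_univ_sum, Fintype.piFinset_univ]

theorem norm_prodVec [DecidableEq ι] (v : ι → Qubit) : ‖prodVec v‖ = ∏ i, ‖v i‖ := by
  have h : ‖prodVec v‖ ^ 2 = (∏ i, ‖v i‖) ^ 2 := by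
    have := inner_prodVec v v
    simp only [inner_self_eq_norm_sq_to_K] at this
    rw [← Finset.prod_pow]
    exact_mod_cast this
  exact (pow_left_inj₀ (norm_nonneg _) (Finset.prod_nonneg fun i _ => norm_nonneg _)
    two_ne_zero).1 h

/-- The norms of the factors multiply to one, so normalizing each factor leaves the product
unchanged. -/
theorem exists_unit_prodVec [DecidableEq ι] {v : ι → Qubit} (hv : ‖prodVec v‖ = 1) :
    ∃ v' : ι → Qubit, (∀ i, ‖v' i‖ = 1) ∧ prodVec v = prodVec v' := by
  have hp : ∏ i, ‖v i‖ = 1 := norm_prodVec v ▸ hv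
  have h0 : ∀ i, ‖v i‖ ≠ 0 := fun i hi => by
    rw [Finset.prod_eq_zero (Finset.mem_univ i) hi] at hp
    exact zero_ne_one hp
  refine ⟨fun i => ((‖v i‖ : ℂ)⁻¹) • v i, fun i => ?_, ?_⟩
  · simp [norm_smul, h0 i]
  · rw [prodVec_smul, Finset.prod_inv_distrib, ← Complex.ofReal_prod, hp]
    simp

theorem IsEntangled.ne_prodVec [DecidableEq ι] {ψ : QubitSystem ι} (h : IsEntangled ψ)
    (v : ι → Qubit) : ψ ≠ prodVec v := fun hv => by
  obtain ⟨v', h1, h2⟩ := exists_unit_prodVec (v := v) (hv ▸ h.1)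
  exact h.2 ⟨v', h1, hv.trans h2⟩

theorem localOp_apply [DecidableEq ι] (A : ι → Matrix (Fin 2) (Fin 2) ℂ) (ψ : QubitSystem ι)
    (x : ι → Fin 2) : localOp A ψ x = ∑ y, (∏ i, A i (x i) (y i)) * ψ y := rfl

theorem localOp_add [DecidableEq ι] (A : ι → Matrix (Fin 2) (Fin 2) ℂ) (ψ φ : QubitSystem ι) :
    localOp A (ψ + φ) = localOp A ψ + localOp A φ := by
  ext x
  simp [localOp_apply, mul_add, Finset.sum_add_distrib]

theorem localOp_smul [DecidableEq ι] (A : ι → Matrix (Fin 2) (Fin 2) ℂ) (c : ℂ)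
    (ψ : QubitSystem ι) : localOp A (c • ψ) = c • localOp A ψ := by
  ext x
  simp [localOp_apply, Finset.mul_sum, mul_left_comm]

theorem localOp_prodVec [DecidableEq ι] (A : ι → Matrix (Fin 2) (Fin 2) ℂ) (v : ι → Qubit) :
    localOp A (prodVec v) = prodVec fun i => WithLp.toLp 2 (A i *ᵥ (v i).ofLp) := by
  ext x
  simp only [localOp_apply, prodVec_apply, ← Finset.prod_mul_distrib, Matrix.mulVec, dotProduct]
  rw [Finset.prod_univ_sum, Fintype.piFinset_univ]

theorem prodVec_ket_const [DecidableEq ι] (b : Fin 2) (x : ι → Fin 2) :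
    prodVec (fun _ : ι => ket b) x = if ∀ i, x i = b then 1 else 0 := by
  simp only [prodVec_apply, ket, PiLp.single_apply]
  split_ifs with h
  · simp [h]
  · push Not at h
    obtain ⟨i, hi⟩ := h
    exact Finset.prod_eq_zero (Finset.mem_univ i) (if_neg hi)

/-- The determinant of a pair of single-qubit vectors in the computational basis. -/
def pairDet (u w : Qubit) : ℂ := u 0 * w 1 - u 1 * w 0

theorem exists_dual_matrix {u w : Qubit} (h : pairDet u w ≠ 0) :
    ∃ B : Matrix (Fin 2) (Fin 2) ℂ, IsUnit B ∧ B *ᵥ u.ofLp = (ket 0).ofLp ∧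
      B *ᵥ w.ofLp = (ket 1).ofLp := by
  have hM : IsUnit (!![u 0, w 0; u 1, w 1] : Matrix (Fin 2) (Fin 2) ℂ).det := by
    rw [Matrix.det_fin_two_of, isUnit_iff_ne_zero]
    unfold pairDet at h
    contrapose! h
    linear_combination h
  set M : Matrix (Fin 2) (Fin 2) ℂ := !![u 0, w 0; u 1, w 1] with hMdef
  have hu : u.ofLp = M *ᵥ (ket 0).ofLp := by
    ext i
    fin_cases i <;> simp [hMdef, ket, Matrix.mulVec, dotProduct]
  have hw : w.ofLp = M *ᵥ (ket 1).ofLp := by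
    ext i
    fin_cases i <;> simp [hMdef, ket, Matrix.mulVec, dotProduct]
  refine ⟨M⁻¹, ?_, ?_, ?_⟩
  · rw [Matrix.isUnit_nonsing_inv_iff, Matrix.isUnit_iff_isUnit_det]
    exact hM
  · rw [hu, Matrix.mulVec_mulVec, Matrix.nonsing_inv_mul _ hM, Matrix.one_mulVec]
  · rw [hw, Matrix.mulVec_mulVec, Matrix.nonsing_inv_mul _ hM, Matrix.one_mulVec]

theorem exists_common_of_pairDet_eq_zero {u w : Qubit} (h : pairDet u w = 0) :
    ∃ (x : Qubit) (s t : ℂ), u = s • x ∧ w = t • x := by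
  unfold pairDet at h
  by_cases h0 : u 0 = 0
  · by_cases h1 : u 1 = 0
    · refine ⟨w, 0, 1, ?_, by simp⟩
      ext i
      fin_cases i <;> simp [h0, h1]
    · refine ⟨u, 1, w 1 / u 1, by simp, ?_⟩
      ext i
      fin_cases i
      · have : u 1 * w 0 = 0 := by linear_combination -h + w 1 * h0
        simpa [h0, h1] using this
      · simp [h1]
  · refine ⟨u, 1, w 0 / u 0, by simp, ?_⟩
    ext i
    fin_cases i
    · simp [h0]
    · change w 1 = w 0 / u 0 * u 1
      field_simp
      linear_combination h

/-! ### Slices and the range of the reduced state -/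

variable [DecidableEq ι]

/-- The (unnormalized) state of the remaining qubits when qubit `k` is found in `|b⟩`. -/
def slice (k : ι) (b : Fin 2) (ψ : QubitSystem ι) : QubitSystem {i : ι // i ≠ k} :=
  WithLp.toLp 2 fun x => ψ (insertBit k b x)

theorem slice_apply (k : ι) (b : Fin 2) (ψ : QubitSystem ι) (x : {i : ι // i ≠ k} → Fin 2) :
    slice k b ψ x = ψ (insertBit k b x) := rfl

theorem slice_add (k : ι) (b : Fin 2) (ψ φ : QubitSystem ι) :
    slice k b (ψ + φ) = slice k b ψ + slice k b φ := rfl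

theorem slice_smul (k : ι) (b : Fin 2) (c : ℂ) (ψ : QubitSystem ι) :
    slice k b (c • ψ) = c • slice k b ψ := rfl

theorem slice_prodVec (k : ι) (b : Fin 2) (v : ι → Qubit) :
    slice k b (prodVec v) = v k b • prodVec fun i : {i : ι // i ≠ k} => v i := by
  ext x
  simp only [slice_apply, prodVec_apply, PiLp.smul_apply, smul_eq_mul]
  rw [Fintype.prod_eq_mul_prod_subtype_ne _ k]
  congr 1
  · simp [insertBit]
  · exact Finset.prod_congr rfl fun i _ => by simp [insertBit, i.2]

theorem ext_slice {k : ι} {ψ φ : QubitSystem ι} (h : ∀ b, slice k b ψ = slice k b φ) : ψ = φ := by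
  ext x
  have hx : insertBit k (x k) (fun i => x i) = x := by
    ext i
    by_cases hi : i = k
    · subst hi; simp [insertBit]
    · simp [insertBit, hi]
  simpa [slice_apply, hx] using congrArg (fun χ => χ.ofLp fun i => x i) (h (x k))

/-- The family which is `a` at `k` and `v` elsewhere. -/
def insertQubit (k : ι) (a : Qubit) (v : {i : ι // i ≠ k} → Qubit) : ι → Qubit :=
  fun i => if h : i = k then a else v ⟨i, h⟩

theorem slice_prodVec_insertQubit (k : ι) (b : Fin 2) (a : Qubit) (v : {i : ι // i ≠ k} → Qubit) :
    slice k b (prodVec (insertQubit k a v)) = a b • prodVec v := by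
  rw [slice_prodVec]
  congr 1
  · simp [insertQubit]
  · congr 1
    ext1 i
    simp [insertQubit, i.2]

section Separable

variable {k : ι} {ψ : QubitSystem ι} {n : ℕ} {p : Fin n → ℝ}
  {v : Fin n → {i : ι // i ≠ k} → Qubit}

theorem sum_slice_eq_sum_prodVec
    (hρ : partialTrace k (ketBra ψ) = ∑ j, (p j : ℂ) • ketBra (prodVec (v j)))
    (F G : ({i : ι // i ≠ k} → Fin 2) → ℂ) :
    ∑ b, (∑ x, F x * slice k b ψ x) * star (∑ y, G y * slice k b ψ y) =
      ∑ j, (p j : ℂ) * ((∑ x, F x * prodVec (v j) x) * star (∑ y, G y * prodVec (v j) y)) := by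
  have h : ∀ x y, ∑ b, slice k b ψ x * star (slice k b ψ y) =
      ∑ j, (p j : ℂ) * (prodVec (v j) x * star (prodVec (v j) y)) := fun x y => by
    have := congrFun (congrFun hρ x) y
    rw [Matrix.sum_apply] at this
    simpa [partialTrace, ketBra, slice_apply] using this
  have key : ∀ f : QubitSystem {i : ι // i ≠ k},
      (∑ x, F x * f x) * star (∑ y, G y * f y) =
        ∑ x, ∑ y, F x * star (G y) * (f x * star (f y)) := fun f => by
    rw [star_sum, Finset.sum_mul_sum]
    refine Finset.sum_congr rfl fun x _ => Finset.sum_congr rfl fun y _ => ?_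
    rw [star_mul']
    ring
  simp only [key]
  rw [Finset.sum_comm]
  simp only [Finset.mul_sum]
  rw [Finset.sum_comm (s := (Finset.univ : Finset (Fin n)))]
  refine Finset.sum_congr rfl fun x _ => ?_
  rw [Finset.sum_comm, Finset.sum_comm (s := (Finset.univ : Finset (Fin n)))]
  refine Finset.sum_congr rfl fun y _ => ?_
  rw [← Finset.mul_sum, h x y, Finset.mul_sum]
  exact Finset.sum_congr rfl fun j _ => by ring

/-- Pairing the reduced state with `F` on both sides gives two sums of nonnegative terms with equal
value; each is zero exactly when all its terms are. -/
theorem slice_vanish_iff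
    (hρ : partialTrace k (ketBra ψ) = ∑ j, (p j : ℂ) • ketBra (prodVec (v j)))
    (hp : ∀ j, 0 ≤ p j) (F : ({i : ι // i ≠ k} → Fin 2) → ℂ) :
    (∀ b, ∑ x, F x * slice k b ψ x = 0) ↔ ∀ j, p j ≠ 0 → ∑ x, F x * prodVec (v j) x = 0 := by
  have h := sum_slice_eq_sum_prodVec hρ F F
  have hs : ∀ z : ℂ, z * star z = ((‖z‖ ^ 2 : ℝ) : ℂ) := fun z => by
    rw [Complex.star_def, Complex.mul_conj, Complex.normSq_eq_norm_sq]
  simp only [hs, ← Complex.ofReal_mul, ← Complex.ofReal_sum] at h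
  have h' := Complex.ofReal_injective h
  have h1 := Finset.sum_eq_zero_iff_of_nonneg (s := Finset.univ)
    (f := fun b => ‖∑ x, F x * slice k b ψ x‖ ^ 2) fun b _ => sq_nonneg _
  have h2 := Finset.sum_eq_zero_iff_of_nonneg (s := Finset.univ)
    (f := fun j => p j * ‖∑ x, F x * prodVec (v j) x‖ ^ 2)
    fun j _ => mul_nonneg (hp j) (sq_nonneg _)
  rw [h', h2] at h1
  simp only [Finset.mem_univ, forall_const, mul_eq_zero, pow_eq_zero_iff two_ne_zero,
    norm_eq_zero] at h1
  rw [← h1]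
  exact forall_congr' fun j => or_iff_not_imp_left

theorem span_slice_eq
    (hρ : partialTrace k (ketBra ψ) = ∑ j, (p j : ℂ) • ketBra (prodVec (v j)))
    (hp : ∀ j, 0 ≤ p j) :
    Submodule.span ℂ (Set.range fun b => slice k b ψ) =
      Submodule.span ℂ {φ | ∃ j, p j ≠ 0 ∧ φ = prodVec (v j)} := by
  have hi : ∀ z f : QubitSystem {i : ι // i ≠ k}, inner ℂ z f = ∑ x, star (z x) * f x :=
    fun z f => by simp [PiLp.inner_apply, mul_comm]
  apply le_antisymm
  · rw [Submodule.span_le]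
    rintro _ ⟨b, rfl⟩
    rw [SetLike.mem_coe, ← Submodule.orthogonal_orthogonal (Submodule.span ℂ {φ | _}),
      Submodule.mem_orthogonal]
    intro z hz
    rw [Submodule.mem_orthogonal'] at hz
    change inner ℂ z (slice k b ψ) = 0
    rw [hi]
    refine (slice_vanish_iff hρ hp fun x => star (z x)).2 (fun j hj => ?_) b
    rw [← hi]
    exact hz _ (Submodule.subset_span ⟨j, hj, rfl⟩)
  · rw [Submodule.span_le]
    rintro _ ⟨j, hj, rfl⟩
    rw [SetLike.mem_coe, ← Submodule.orthogonal_orthogonal (Submodule.span ℂ (Set.range _)),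
      Submodule.mem_orthogonal]
    intro z hz
    rw [Submodule.mem_orthogonal'] at hz
    rw [hi]
    refine (slice_vanish_iff hρ hp fun x => star (z x)).1 (fun b => ?_) j hj
    rw [← hi]
    exact hz _ (Submodule.subset_span ⟨b, rfl⟩)

end Separable

/-! ### Decomposition into two product terms -/

theorem exists_weight_ne_zero {n : ℕ} {p : Fin n → ℝ} (hp : ∑ j, p j = 1) : ∃ j, p j ≠ 0 := by
  by_contra! h
  simp [h] at hp

theorem prodVec_ne_zero {v : ι → Qubit} (hv : ∀ i, ‖v i‖ = 1) : prodVec v ≠ 0 := by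
  rw [← norm_ne_zero_iff, norm_prodVec]
  simp [hv]

theorem exists_prodVec_of_slice_mem_span {k : ι} {ψ : QubitSystem ι}
    {v : {i : ι // i ≠ k} → Qubit}
    (h : ∀ b, slice k b ψ ∈ Submodule.span ℂ {prodVec v}) : ∃ u : ι → Qubit, ψ = prodVec u := by
  simp only [Submodule.mem_span_singleton] at h
  choose c hc using h
  exact ⟨insertQubit k (WithLp.toLp 2 c) v, ext_slice (k := k) fun b => by
    rw [slice_prodVec_insertQubit, ← hc b]⟩

theorem exists_eq_prodVec_add_prodVec {k : ι} {ψ : QubitSystem ι}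
    (hρ : IsSeparableState (partialTrace k (ketBra ψ))) :
    ∃ u w : ι → Qubit, ψ = prodVec u + prodVec w := by
  obtain ⟨n, p, v, hp, hsum, hv, hρ⟩ := hρ
  have hspan := span_slice_eq hρ hp
  set S := Submodule.span ℂ (Set.range fun b => slice k b ψ) with hS
  have hmem : ∀ b, slice k b ψ ∈ S := fun b => Submodule.subset_span ⟨b, rfl⟩
  have hmemV : ∀ j, p j ≠ 0 → prodVec (v j) ∈ S := fun j hj => by
    rw [hspan]
    exact Submodule.subset_span ⟨j, hj, rfl⟩
  suffices h : ∃ f g : {i : ι // i ≠ k} → Qubit,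
      ∀ b, slice k b ψ ∈ Submodule.span ℂ {prodVec f, prodVec g} by
    obtain ⟨f, g, h⟩ := h
    simp only [Submodule.mem_span_pair] at h
    choose c d hcd using h
    exact ⟨insertQubit k (WithLp.toLp 2 c) f, insertQubit k (WithLp.toLp 2 d) g,
      ext_slice (k := k) fun b => by
        rw [slice_add, slice_prodVec_insertQubit, slice_prodVec_insertQubit, ← hcd b]⟩
  obtain ⟨a, ha⟩ := exists_weight_ne_zero hsum
  by_cases hall : ∀ j, p j ≠ 0 → prodVec (v j) ∈ Submodule.span ℂ {prodVec (v a)}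
  · refine ⟨v a, v a, fun b => ?_⟩
    have hle : S ≤ Submodule.span ℂ {prodVec (v a)} := by
      rw [hspan, Submodule.span_le]
      rintro _ ⟨j, hj, rfl⟩
      exact hall j hj
    simpa using hle (hmem b)
  · push Not at hall
    obtain ⟨c, hc, hca⟩ := hall
    refine ⟨v a, v c, fun b => ?_⟩
    have hli : LinearIndependent ℂ ![prodVec (v a), prodVec (v c)] := by
      rw [LinearIndependent.pair_iff' (prodVec_ne_zero (hv a))]
      intro r hr
      exact hca (hr ▸ Submodule.smul_mem _ r (Submodule.mem_span_singleton_self _))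
    have hfin : Module.finrank ℂ S ≤ 2 := by
      exact (finrank_range_le_card (R := ℂ) fun b => slice k b ψ).trans_eq (Fintype.card_fin 2)
    -- Two independent product vectors already fill the range, whose dimension is at most two.
    have hfin' := finrank_span_eq_card hli
    rw [Matrix.range_cons, Matrix.range_cons, Matrix.range_empty, Set.union_empty,
      Set.singleton_union] at hfin'
    have hle : Submodule.span ℂ {prodVec (v a), prodVec (v c)} ≤ S := by
      rw [Submodule.span_le]
      rintro _ (rfl | rfl)
      · exact hmemV a ha
      · exact hmemV c hc
    rw [Submodule.eq_of_le_of_finrank_le hle (by rw [hfin']; simpa using hfin)]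
    exact hmem b

theorem pairDet_ne_zero_of_isFragile {k : ι} {ψ : QubitSystem ι} (h : IsFragile k ψ)
    {u w : ι → Qubit} (hψ : ψ = prodVec u + prodVec w) : pairDet (u k) (w k) ≠ 0 := by
  intro h0
  obtain ⟨hent, n, p, v, hp, hsum, hv, hρ⟩ := h
  obtain ⟨x, s, t, hu, hw⟩ := exists_common_of_pairDet_eq_zero h0
  obtain ⟨a, ha⟩ := exists_weight_ne_zero hsum
  set χ : QubitSystem {i : ι // i ≠ k} :=
    s • prodVec (fun i : {i : ι // i ≠ k} => u i) + t • prodVec (fun i : {i : ι // i ≠ k} => w i) with hχ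
  have hslice : ∀ b, slice k b ψ = x b • χ := fun b => by
    rw [hψ, slice_add, slice_prodVec, slice_prodVec, hu, hw, hχ, smul_add, smul_smul, smul_smul]
    simp [mul_comm]
  have hmem : prodVec (v a) ∈ Submodule.span ℂ {χ} := by
    have h1 : prodVec (v a) ∈ Submodule.span ℂ (Set.range fun b => slice k b ψ) := by
      rw [span_slice_eq hρ hp]
      exact Submodule.subset_span ⟨a, ha, rfl⟩
    refine Submodule.span_le.2 ?_ h1
    rintro _ ⟨b, rfl⟩
    simp only [hslice]
    exact Submodule.smul_mem _ _ (Submodule.mem_span_singleton_self _)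
  obtain ⟨r, hr⟩ := Submodule.mem_span_singleton.1 hmem
  have hr0 : r ≠ 0 := by
    rintro rfl
    exact prodVec_ne_zero (hv a) (by rw [← hr, zero_smul])
  obtain ⟨u', hu'⟩ := exists_prodVec_of_slice_mem_span (k := k) (ψ := ψ) (v := v a) fun b => by
    rw [hslice, ← hr, Submodule.mem_span_singleton]
    exact ⟨x b * r⁻¹, by rw [smul_smul, mul_assoc, inv_mul_cancel₀ hr0, mul_one]⟩
  exact hent.ne_prodVec u' hu'

/-! ### Vanishing coherence and orthogonality -/

/-- This is the vanishing of a 2×2 minor across the cut between `m` and the rest: swapping bit `m`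
between the two labels permutes the factors. -/
theorem prodVec_mul_prodVec_mix (v : ι → Qubit) (m : ι) :
    prodVec v (fun _ => 0) * prodVec v (fun _ => 1) =
      prodVec v (Function.update (fun _ => 0) m 1) *
        prodVec v (Function.update (fun _ => 1) m 0) := by
  simp only [prodVec_apply, ← Finset.prod_mul_distrib]
  refine Finset.prod_congr rfl fun i _ => ?_
  by_cases hi : i = m
  · subst hi
    simp [mul_comm]
  · simp [hi]

theorem localOp_pair_apply {B : ι → Matrix (Fin 2) (Fin 2) ℂ} {u w : ι → Qubit}
    (hu : ∀ i, B i *ᵥ (u i).ofLp = (ket 0).ofLp) (hw : ∀ i, B i *ᵥ (w i).ofLp = (ket 1).ofLp)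
    (a b : ℂ) (x : ι → Fin 2) :
    localOp B (a • prodVec u + b • prodVec w) x =
      a * (if ∀ i, x i = 0 then 1 else 0) + b * (if ∀ i, x i = 1 then 1 else 0) := by
  rw [localOp_add, localOp_smul, localOp_smul, localOp_prodVec, localOp_prodVec]
  simp only [hu, hw, WithLp.toLp_ofLp, PiLp.add_apply, PiLp.smul_apply, prodVec_ket_const,
    smul_eq_mul]

theorem localOp_pair_apply_mixed {B : ι → Matrix (Fin 2) (Fin 2) ℂ} {u w : ι → Qubit}
    (hu : ∀ i, B i *ᵥ (u i).ofLp = (ket 0).ofLp) (hw : ∀ i, B i *ᵥ (w i).ofLp = (ket 1).ofLp)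
    (a b : ℂ) {m l : ι} (hml : l ≠ m) :
    localOp B (a • prodVec u + b • prodVec w) (Function.update (fun _ => 0) m 1) = 0 := by
  rw [localOp_pair_apply hu hw, if_neg, if_neg, mul_zero, mul_zero, add_zero]
  · intro h
    simpa [hml] using h l
  · intro h
    simpa using h m

theorem add_prodVec_ne_prodVec [Nontrivial ι] {u w : ι → Qubit}
    (h : ∀ i, pairDet (u i) (w i) ≠ 0) {a b : ℂ} (ha : a ≠ 0) (hb : b ≠ 0) (v : ι → Qubit) :
    a • prodVec u + b • prodVec w ≠ prodVec v := by
  intro hv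
  choose B _ hu hw using fun i => exists_dual_matrix (h i)
  obtain ⟨m, l, hml⟩ := exists_pair_ne ι
  have h0 := localOp_pair_apply hu hw a b fun _ => 0
  have h1 := localOp_pair_apply hu hw a b fun _ => 1
  have hm := localOp_pair_apply_mixed hu hw a b hml.symm
  simp only [hv, localOp_prodVec] at h0 h1 hm
  have := prodVec_mul_prodVec_mix (fun i => WithLp.toLp 2 (B i *ᵥ (v i).ofLp)) m
  rw [h0, h1, hm] at this
  simp [ha, hb] at this

theorem inner_eq_zero_of_isSeparableState {k m l : ι} (hm : m ≠ k) (hl : l ≠ k) (hlm : l ≠ m)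
    {ψ : QubitSystem ι} (hρ : IsSeparableState (partialTrace k (ketBra ψ))) {u w : ι → Qubit}
    (h : ∀ i, pairDet (u i) (w i) ≠ 0) {a b : ℂ} (ha : a ≠ 0) (hb : b ≠ 0)
    (hψ : ψ = a • prodVec u + b • prodVec w) : inner ℂ (u k) (w k) = 0 := by
  obtain ⟨n, p, v, hp, -, -, hρ⟩ := hρ
  choose B _ hu hw using fun i : {i : ι // i ≠ k} => exists_dual_matrix (h i)
  have hslice : ∀ c, slice k c ψ =
      (a * u k c) • prodVec (fun i : {i : ι // i ≠ k} => u i) +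
        (b * w k c) • prodVec (fun i : {i : ι // i ≠ k} => w i) := fun c => by
    rw [hψ, slice_add, slice_smul, slice_smul, slice_prodVec, slice_prodVec, smul_smul, smul_smul]
  have hL : ∀ (x : {i : ι // i ≠ k} → Fin 2) (φ : QubitSystem {i : ι // i ≠ k}),
      ∑ y, (∏ i, B i (x i) (y i)) * φ y = localOp B φ x := fun _ _ => rfl
  have hmix : ∀ j, p j ≠ 0 → localOp B (prodVec (v j))
      (Function.update (fun _ => 0) ⟨m, hm⟩ 1) = 0 := by
    -- The functional is the row of `⊗ B` at a mixed label; a second remaining qubit `l` keeps that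
    -- label from being all ones.
    refine (slice_vanish_iff hρ hp fun y => ∏ i, B i _ (y i)).1 fun c => ?_
    rw [hL, hslice]
    exact localOp_pair_apply_mixed hu hw _ _ (l := ⟨l, hl⟩) (by simpa using hlm)
  -- The entry of the transformed reduced state between all ones and all zeros, computed in both
  -- decompositions.
  have key := sum_slice_eq_sum_prodVec hρ (fun y => ∏ i, B i 1 (y i)) (fun y => ∏ i, B i 0 (y i))
  have h0 := hL fun _ => 0
  have h1 := hL fun _ => 1
  simp only [h0, h1, hslice, localOp_pair_apply hu hw] at key
  have hne : ¬ ∀ _ : {i : ι // i ≠ k}, False := fun h => h ⟨m, hm⟩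
  rw [Finset.sum_eq_zero (s := (Finset.univ : Finset (Fin n)))] at key
  · simp only [one_ne_zero, zero_ne_one, if_neg hne, implies_true, if_true, mul_zero, mul_one,
      zero_add, add_zero, Fin.sum_univ_two, star_mul'] at key
    have hsa : star a ≠ 0 := star_ne_zero.2 ha
    have : b * star a * inner ℂ (u k) (w k) = 0 := by
      rw [← key]
      simp [PiLp.inner_apply, Fin.sum_univ_two]
      ring
    simpa [hb, ha] using this
  · intro j _
    by_cases hj : p j = 0
    · simp [hj]
    · have hv := prodVec_mul_prodVec_mix (fun i => WithLp.toLp 2 (B i *ᵥ (v j i).ofLp)) ⟨m, hm⟩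
      rw [← localOp_prodVec, hmix j hj, zero_mul] at hv
      rcases mul_eq_zero.1 hv with h | h <;> simp [h]

/-! ### GHZ form and scaling to the GHZ state -/

theorem exists_isGHZForm [Nonempty ι] {ψ : QubitSystem ι} (hnorm : ‖ψ‖ = 1) {u w : ι → Qubit}
    (hψ : ψ = prodVec u + prodVec w) (hu : ∀ i, u i ≠ 0) (hw : ∀ i, w i ≠ 0)
    (horth : ∀ i, inner ℂ (u i) (w i) = 0) :
    ∃ (a b : ℂ) (e e' : ι → Qubit), IsGHZForm ψ a b e e' := by
  have key : ∀ f : ι → Qubit, (∀ i, f i ≠ 0) →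
      prodVec f = ((∏ i, ‖f i‖ : ℝ) : ℂ) • prodVec fun i => ((‖f i‖ : ℂ)⁻¹) • f i := by
    intro f hf
    rw [prodVec_smul, smul_smul, Finset.prod_inv_distrib, Complex.ofReal_prod, mul_inv_cancel₀,
      one_smul]
    exact Finset.prod_ne_zero_iff.2 fun i _ => by simpa using hf i
  have hunit : ∀ f : ι → Qubit, (∀ i, f i ≠ 0) → ∀ i, ‖((‖f i‖ : ℂ)⁻¹) • f i‖ = 1 := by
    intro f hf i
    simp [norm_smul, hf i]
  have hne : ∀ f : ι → Qubit, (∀ i, f i ≠ 0) → ((∏ i, ‖f i‖ : ℝ) : ℂ) ≠ 0 := fun f hf =>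
    Complex.ofReal_ne_zero.2 (Finset.prod_ne_zero_iff.2 fun i _ => norm_ne_zero_iff.2 (hf i))
  refine ⟨_, _, _, _, hne u hu, hne w hw, ?_, hunit u hu, hunit w hw, fun i => ?_, ?_⟩
  · have h0 : inner ℂ (prodVec u) (prodVec w) = 0 := by
      rw [inner_prodVec]
      exact Finset.prod_eq_zero (Finset.mem_univ (Classical.arbitrary ι)) (horth _)
    have := norm_add_sq_eq_norm_sq_add_norm_sq_of_inner_eq_zero _ _ h0
    rw [← hψ, hnorm, norm_prodVec, norm_prodVec] at this
    simp only [Complex.norm_real, Real.norm_eq_abs, sq_abs]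
    linarith
  · simp [horth i]
  · rw [← key u hu, ← key w hw, hψ]

theorem scaling_root_ne_zero (N : ℕ) {a : ℂ} (ha : a ≠ 0) :
    ((Real.sqrt 2 : ℂ) * a) ^ (-(1 : ℂ) / N) ≠ 0 := by
  rw [Complex.cpow_ne_zero_iff]
  left
  simpa using ha

theorem isUnit_scaling (N : ℕ) {a b : ℂ} (ha : a ≠ 0) (hb : b ≠ 0) : IsUnit (scaling N a b) := by
  rw [Matrix.isUnit_iff_isUnit_det, scaling, Matrix.det_diagonal, isUnit_iff_ne_zero]
  rw [Fin.prod_univ_two]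
  exact mul_ne_zero (scaling_root_ne_zero N ha) (scaling_root_ne_zero N hb)

/-- A natural power of a principal complex power multiplies exponents without branch ambiguity. -/
theorem scaling_root_pow_mul {N : ℕ} (hN : N ≠ 0) {a : ℂ} (ha : a ≠ 0) :
    (((Real.sqrt 2 : ℂ) * a) ^ (-(1 : ℂ) / N)) ^ N * a = (Real.sqrt 2 : ℂ)⁻¹ := by
  have hN' : (N : ℂ) ≠ 0 := Nat.cast_ne_zero.2 hN
  rw [← Complex.cpow_nat_mul, mul_div_cancel₀ _ hN', Complex.cpow_neg_one, mul_inv, mul_assoc,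
    inv_mul_cancel₀ ha, mul_one]

theorem localOp_eq_GHZ {N : ℕ} {A : Fin N → Matrix (Fin 2) (Fin 2) ℂ} {e e' : Fin N → Qubit}
    {a b c d : ℂ} (he : ∀ i, A i *ᵥ (e i).ofLp = c • (ket 0).ofLp)
    (he' : ∀ i, A i *ᵥ (e' i).ofLp = d • (ket 1).ofLp)
    (hc : c ^ N * a = (Real.sqrt 2 : ℂ)⁻¹) (hd : d ^ N * b = (Real.sqrt 2 : ℂ)⁻¹) :
    localOp A (a • prodVec e + b • prodVec e') = GHZ N := by
  rw [localOp_add, localOp_smul, localOp_smul, localOp_prodVec, localOp_prodVec]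
  simp only [he, he', WithLp.toLp_smul, WithLp.toLp_ofLp, prodVec_smul, smul_smul,
    Finset.prod_const, Finset.card_univ, Fintype.card_fin]
  rw [mul_comm a, mul_comm b, hc, hd, GHZ, smul_add]

theorem IsGHZForm.scaling_mul {N : ℕ} (hN : N ≠ 0) {ψ : QubitSystem (Fin N)} {a b : ℂ}
    {e e' : Fin N → Qubit} (h : IsGHZForm ψ a b e e') {U : Fin N → Matrix (Fin 2) (Fin 2) ℂ}
    (hU : AlignsToComputationalBasis e e' U) :
    (∀ i, IsUnit (scaling N a b * U i)) ∧ GHZ N = localOp (fun i => scaling N a b * U i) ψ := by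
  refine ⟨fun i => (isUnit_scaling N h.left_ne_zero h.right_ne_zero).mul ?_, ?_⟩
  · exact ⟨⟨U i, star (U i), Matrix.mem_unitaryGroup_iff.1 (hU i).1,
      Matrix.mem_unitaryGroup_iff'.1 (hU i).1⟩, rfl⟩
  · rw [h.eq]
    refine (localOp_eq_GHZ (fun i => ?_) (fun i => ?_) (scaling_root_pow_mul hN h.left_ne_zero)
      (scaling_root_pow_mul hN h.right_ne_zero)).symm
    · rw [← Matrix.mulVec_mulVec, (hU i).2.1]
      ext r
      fin_cases r <;> simp [scaling, Matrix.mulVec_diagonal, ket]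
    · rw [← Matrix.mulVec_mulVec, (hU i).2.2]
      ext r
      fin_cases r <;> simp [scaling, Matrix.mulVec_diagonal, ket]

/-! ### Fragile and robust states of at least three qubits -/

theorem exists_two_others {N : ℕ} (hN : 3 ≤ N) (k : Fin N) :
    ∃ m l : Fin N, m ≠ k ∧ l ≠ k ∧ l ≠ m := by
  have hk := Finset.card_erase_of_mem (Finset.mem_univ k)
  rw [Finset.card_univ, Fintype.card_fin] at hk
  obtain ⟨m, hm, l, hl, hml⟩ := Finset.one_lt_card.1 (hk.symm ▸ (by omega : 1 < N - 1))
  exact ⟨m, l, Finset.ne_of_mem_erase hm, Finset.ne_of_mem_erase hl, hml.symm⟩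

theorem exists_isGHZForm_of_forall_isFragile {N : ℕ} (hN : 3 ≤ N) {ψ : QubitSystem (Fin N)}
    (h : ∀ k, IsFragile k ψ) : ∃ (a b : ℂ) (e e' : Fin N → Qubit), IsGHZForm ψ a b e e' := by
  have k₀ : Fin N := ⟨0, by omega⟩
  have : Nonempty (Fin N) := ⟨k₀⟩
  obtain ⟨u, w, hψ⟩ := exists_eq_prodVec_add_prodVec (h k₀).2
  have hdet : ∀ i, pairDet (u i) (w i) ≠ 0 := fun i => pairDet_ne_zero_of_isFragile (h i) hψ
  refine exists_isGHZForm (h k₀).1.1 hψ (fun i hi => hdet i ?_) (fun i hi => hdet i ?_) fun k => ?_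
  · simp [pairDet, hi]
  · simp [pairDet, hi]
  · obtain ⟨m, l, hm, hl, hlm⟩ := exists_two_others hN k
    exact inner_eq_zero_of_isSeparableState hm hl hlm (h k).2 hdet one_ne_zero one_ne_zero
      (by simpa using hψ)

theorem exists_robust_mem_SLOCCClass {N : ℕ} (hN : 3 ≤ N) :
    ∃ ψ ∈ SLOCCClass (GHZ N), ∀ k, IsRobust k ψ := by
  have : Nontrivial (Fin N) := Fin.nontrivial_iff_two_le.2 (by omega)
  have hN0 : N ≠ 0 := by omega
  -- Independent of `ket 0`, which gives the GHZ class and entanglement, but not orthogonal to it,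
  -- which gives robustness.
  set v : Qubit := ket 0 + ket 1 with hv
  have hdet : ∀ _ : Fin N, pairDet (ket 0) v ≠ 0 := fun _ => by simp [pairDet, hv, ket]
  set φ : QubitSystem (Fin N) := prodVec (fun _ => ket 0) + prodVec (fun _ => v) with hφ
  have hφ0 : φ ≠ 0 := fun h0 => by
    -- The zero vector is itself a product, of zero factors.
    refine add_prodVec_ne_prodVec hdet one_ne_zero one_ne_zero (fun _ => 0) ?_
    rw [one_smul, one_smul, ← hφ, h0]
    ext x
    simp [prodVec_apply, hN0]
  have hc : ((‖φ‖ : ℂ)⁻¹) ≠ 0 := by simpa using hφ0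
  set c : ℂ := (‖φ‖ : ℂ)⁻¹ with hcdef
  have hnorm : ‖c • φ‖ = 1 := by simp [norm_smul, hcdef, hφ0]
  have hψ : c • φ = c • prodVec (fun _ => ket 0) + c • prodVec (fun _ => v) := by
    rw [hφ, smul_add]
  have hent : IsEntangled (c • φ) :=
    ⟨hnorm, fun ⟨f, _, hf⟩ => add_prodVec_ne_prodVec hdet hc hc f (hψ ▸ hf)⟩
  refine ⟨c • φ, ⟨hnorm, ?_⟩, fun k => ⟨hent, fun hsep => ?_⟩⟩
  · obtain ⟨B, hB, hB0, hB1⟩ := exists_dual_matrix (hdet ⟨0, by omega⟩)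
    -- Both terms carry the coefficient `c`, so a scalar replaces the diagonal scaling.
    set s : ℂ := ((Real.sqrt 2 : ℂ) * c) ^ (-(1 : ℂ) / N)
    have hs : s ≠ 0 := scaling_root_ne_zero N hc
    refine ⟨fun _ => s • B, fun _ => ?_, ?_⟩
    · exact (Units.mk0 s hs • hB.unit).isUnit
    · rw [hψ]
      exact (localOp_eq_GHZ (fun _ => by rw [Matrix.smul_mulVec, hB0])
        (fun _ => by rw [Matrix.smul_mulVec, hB1]) (scaling_root_pow_mul hN0 hc)
        (scaling_root_pow_mul hN0 hc)).symm
  · obtain ⟨m, l, hm, hl, hlm⟩ := exists_two_others hN k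
    have := inner_eq_zero_of_isSeparableState hm hl hlm hsep hdet hc hc hψ
    simp [hv, ket, PiLp.inner_apply] at this

end QubitLoss

end

theorem theorem2 (N : ℕ) (hN : 3 ≤ N) :
    (∀ ψ : QubitLoss.QubitSystem (Fin N), (∀ k, QubitLoss.IsFragile k ψ) →
      ψ ∈ QubitLoss.SLOCCClass (QubitLoss.GHZ N) ∧
      (∃ (a b : ℂ) (e e' : Fin N → QubitLoss.Qubit), QubitLoss.IsGHZForm ψ a b e e') ∧
      ∀ (a b : ℂ) (e e' : Fin N → QubitLoss.Qubit), QubitLoss.IsGHZForm ψ a b e e' →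
        (∃ U : Fin N → Matrix (Fin 2) (Fin 2) ℂ,
          QubitLoss.AlignsToComputationalBasis e e' U) ∧
        ∀ U : Fin N → Matrix (Fin 2) (Fin 2) ℂ,
          QubitLoss.AlignsToComputationalBasis e e' U →
          (∀ i, IsUnit (QubitLoss.scaling N a b * U i)) ∧
          QubitLoss.GHZ N = QubitLoss.localOp (fun i => QubitLoss.scaling N a b * U i) ψ) ∧
    ∃ ψ ∈ QubitLoss.SLOCCClass (QubitLoss.GHZ N), ∀ k, QubitLoss.IsRobust k ψ := by
  have hN0 : N ≠ 0 := by omega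
  refine ⟨fun ψ h => ?_, QubitLoss.exists_robust_mem_SLOCCClass hN⟩
  have hform := QubitLoss.exists_isGHZForm_of_forall_isFragile hN h
  refine ⟨⟨(h ⟨0, by omega⟩).1.1, ?_⟩, hform, fun a b e e' hψ =>
    ⟨QubitLoss.exists_alignsToComputationalBasis hψ.norm_left hψ.norm_right hψ.orthogonal,
      fun U hU => hψ.scaling_mul hN0 hU⟩⟩
  obtain ⟨a, b, e, e', hψ⟩ := hform
  obtain ⟨U, hU⟩ :=
    QubitLoss.exists_alignsToComputationalBasis hψ.norm_left hψ.norm_right hψ.orthogonal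
  exact ⟨_, hψ.scaling_mul hN0 hU⟩
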